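/- All logarithms are to base $2$. For a string $s$ over an alphabet $\Sigma$ of size $\sigma$ let $|s|H_0(s)=\sum_{c}n_c\log(|s|/n_c)$, where $n_c$ is the number of occurrences of $c$ in $s$. For constants $\lambda,\mu$, a $(\lambda,\mu)$-zero-th order compressor $\mathcal C$ assigns to every nonempty string $s$ over $\Sigma$ an output size with $$|s|H_0(s)+\log\sigma\;\le\;|\mathcal C(s)|\;\le\;\lambda\,|s|H_0(s)+\mu\log\sigma .$$ The cost of a partition of a string into contiguous nonempty substrings $S_1,\dots,S_k$ is $\sum_{i}|\mathcal C(S_i)|$. The BWT matrix of $T$ has as rows the cyclic rotations of $T$ in lexicographic order, and $\mathrm{BWT}(T)$ is its last column. A *booster partition* of $\mathrm{BWT}(T)$ is given by a finite set $W$ of words, each a prefix of some row, such that every row has exactly one prefix in $W$; for each $w\in W$ it has one substring, the portion of $\mathrm{BWT}(T)$ lying in the rows with prefix $w$. These are the partitions among which the compression booster of Ferragina, Giancarlo, Manzini and Sciortino chooses. For $\alpha\mid\sigma$, divide $\Sigma=\{0<1<\dots<\sigma-1\}$ into $\sigma/\alpha$ groups $\Sigma_0,\Sigma_1,\dots$ of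 $\alpha$ consecutive symbols, and let $\mathcal T_{\sigma,\alpha}$ be the set of concatenations $T=T_0T_1\cdots T_{\sigma/\alpha-1}$ where $T_i$ is a string over $\Sigma_i$ in which, read cyclically, each ordered pair of symbols of $\Sigma_i$ occurs exactly once (a De Bruijn sequence of order two). **Theorem.** There are a strictly increasing sequence of alphabet sizes $\sigma_m$ and positive integers $\alpha_m\mid\sigma_m$ with $\alpha_m=\Theta(\sqrt{\log\sigma_m}/\log\log\sigma_m)$, such that every $\mathcal T_{\sigma_m,\alpha_m}$ is nonempty and, for every $m$ and every $T\in\mathcal T_{\sigma_m,\alpha_m}$, there is a partition $Q_T$ of $\mathrm{BWT}(T)$ (not depending on the compressor) with the following property. For all $\lambda,\mu$ there is a constant $c>0$ such that, for all $m$, all $T\in\mathcal T_{\sigma_m,\alpha_m}$, every $(\lambda,\mu)$-zero-th order compressor $\mathcal C$ over the alphabet of size $\sigma_m$, and every booster partition $P$ of $\mathrm{BWT}(T)$, with $n=|T|$, $$\mathrm{cost}_{\mathcal C}(P)\;\ge\;c\,\sqrt{\log n}\;\,\mathrm{cost}_{\mathcal C}(Q_T).$$ -/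

import Mathlib

open Filter Asymptotics

/-! ## Zero-th order empirical entropy and costs of partitions -/

/-- Zero-th order empirical entropy `H₀(s) = (1/|s|) ∑_c n_c log₂ (|s| / n_c)`, where `n_c` is the
number of occurrences of `c` in `s` (symbols that do not occur contribute `0`). -/
noncomputable def entropy0 {A : Type*} [Fintype A] [DecidableEq A] (s : List A) : ℝ :=
  (1 / (s.length : ℝ)) *
    ∑ c : A, (s.count c : ℝ) * Real.logb 2 ((s.length : ℝ) / (s.count c : ℝ))

/-- `C s` is the size in bits of the output of a zero-th order compressor on a nonempty string `s`
over an alphabet of `σ` symbols: at least `|s| H₀(s)` bits plus a model of at least `log₂ σ` bits,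
and at most `lam * |s| H₀(s) + mu * log₂ σ` bits. -/
def IsZeroOrderCost {A : Type*} [Fintype A] [DecidableEq A] (lam mu : ℝ)
    (C : List A → ℝ) : Prop :=
  ∀ s : List A, s ≠ [] →
    (s.length : ℝ) * entropy0 s + Real.logb 2 (Fintype.card A) ≤ C s ∧
    C s ≤ lam * ((s.length : ℝ) * entropy0 s) + mu * Real.logb 2 (Fintype.card A)

/-- `P` is a partition of the string `L` into contiguous nonempty substrings. -/
def IsPartition {A : Type*} (L : List A) (P : List (List A)) : Prop :=
  (∀ s ∈ P, s ≠ []) ∧ P.flatten = L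

/-- The cost of a partition is the total cost of its substrings. -/
def partitionCost {A : Type*} (C : List A → ℝ) (P : List (List A)) : ℝ :=
  (P.map C).sum

/-! ## The Burrows-Wheeler transform and the partitions of the booster -/

/-- The rows of the BWT matrix of `T`: its `|T|` cyclic rotations, in lexicographic order. -/
def bwtRows {A : Type*} [LinearOrder A] (T : List A) : List (List A) :=
  ((List.range T.length).map (fun i => T.rotate i)).insertionSort (· ≤ ·)

/-- The Burrows-Wheeler transform of `T`: the last column of the BWT matrix. -/
def bwt {A : Type*} [LinearOrder A] (T : List A) : List A :=
  (bwtRows T).filterMap List.getLast?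

/-- The portion of `bwt T` that lies in the rows of the BWT matrix having `w` as a prefix. -/
def contextBlock {A : Type*} [LinearOrder A] (T w : List A) : List A :=
  ((bwtRows T).filter (fun r => w.isPrefixOf r)).filterMap List.getLast?

/-- `W`, a list of words in increasing lexicographic order, is a prefix cover of the BWT matrix of
`T` (equivalently, a leaf cover of the trie of its rows): every word of `W` is a prefix of some row,
and every row has exactly one prefix in `W`. -/
def IsContextCover {A : Type*} [LinearOrder A] (T : List A) (W : List (List A)) : Prop :=
  W.Pairwise (· < ·) ∧
  (∀ w ∈ W, ∃ r ∈ bwtRows T, w <+: r) ∧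
  (∀ r ∈ bwtRows T, ∃! w : List A, w ∈ W ∧ w <+: r)

/-- `P` is one of the partitions of `bwt T` among which the compression booster chooses: it has one
substring `contextBlock T w` for each word `w` of some prefix cover. -/
def IsBoosterPartition {A : Type*} [LinearOrder A] (T : List A) (P : List (List A)) : Prop :=
  ∃ W : List (List A), IsContextCover T W ∧ P = W.map (contextBlock T)

/-! ## Concatenated De Bruijn sequences -/

/-- `s` is a De Bruijn sequence of order two over the alphabet `B`: it consists of symbols of `B`,
and each ordered pair of symbols of `B` occurs in it, read cyclically, exactly once. -/
def IsDeBruijn {A : Type*} [DecidableEq A] (B : Finset A) (s : List A) : Prop :=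
  (∀ x ∈ s, x ∈ B) ∧ ∀ x ∈ B, ∀ y ∈ B, (s.zip (s.rotate 1)).count (x, y) = 1

/-- The `i`-th group of `a` consecutive symbols of the alphabet `0 < 1 < ⋯ < σ - 1`. -/
def subAlphabet (σ a i : ℕ) : Finset (Fin σ) :=
  Finset.univ.filter (fun x => (x : ℕ) / a = i)

/-- `T` is a concatenation `T₀ T₁ ⋯` of `σ / a` strings, the `i`-th of which is a De Bruijn sequence
over the `i`-th group of `a` consecutive symbols. -/
def IsDeBruijnConcat (σ a : ℕ) (T : List (Fin σ)) : Prop :=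
  ∃ S : ℕ → List (Fin σ),
    (∀ i < σ / a, IsDeBruijn (subAlphabet σ a i) (S i)) ∧
    T = ((List.range (σ / a)).map S).flatten

/-! Put `D = a * q` with `q = log D` and `log σ = D ^ 2`. In a text where every symbol occurs
exactly `a` times, a booster partition has no cheap option. If its cover contains the empty word, it
is the whole BWT, whose entropy is `σ * a * log σ`. Otherwise every symbol starts some word of the
cover, so there are at least `σ` pieces, each paying a header `log σ`. Either way the cost is at
least `σ * D ^ 2` (`le_partitionCost_of_isBoosterPartition`).

Cutting the BWT by blocks of `D` consecutive first symbols is not a prefix cover, since it merges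
neighbouring contexts. Such a block is a union of `q` groups, and the text passes through the groups
in order, so a piece uses at most `D + 1` symbols (`exists_finset_keyBlock`). The entropy then
totals at most `σ * a * log (D + 1) ≤ 2 * σ * D`, and the headers at most `(σ / D) * D ^ 2 = σ * D`.
The ratio is of order `D`, that is `√(log n)`. Of the De Bruijn property only the symbol counts are
used. -/

/-! ### Entropy bounds. -/

section Entropy

variable {A : Type*} [Fintype A] [DecidableEq A]

theorem length_mul_entropy0 (s : List A) :
    (s.length : ℝ) * entropy0 s =
      ∑ c : A, (s.count c : ℝ) * Real.logb 2 ((s.length : ℝ) / (s.count c : ℝ)) := by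
  rcases eq_or_ne s [] with rfl | hs
  · simp
  · have : (s.length : ℝ) ≠ 0 := by simpa using hs
    rw [entropy0, ← mul_assoc, mul_one_div_cancel this, one_mul]

theorem length_mul_entropy0_nonneg (s : List A) : 0 ≤ (s.length : ℝ) * entropy0 s := by
  rw [length_mul_entropy0]
  refine Finset.sum_nonneg fun c _ => ?_
  rcases Nat.eq_zero_or_pos (s.count c) with h | h
  · simp [h]
  · refine mul_nonneg (Nat.cast_nonneg _) (Real.logb_nonneg one_lt_two ?_)
    rw [le_div_iff₀ (by exact_mod_cast h), one_mul]
    exact_mod_cast List.count_le_length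

theorem logb_card_le_of_isZeroOrderCost {lam mu : ℝ} {C : List A → ℝ}
    (hC : IsZeroOrderCost lam mu C) {s : List A} (hs : s ≠ []) :
    Real.logb 2 (Fintype.card A) ≤ C s := by
  linarith [(hC s hs).1, length_mul_entropy0_nonneg s]

theorem sum_count_eq_length {A : Type*} [DecidableEq A] {s : List A} {F : Finset A}
    (hF : ∀ x ∈ s, x ∈ F) : ∑ c ∈ F, s.count c = s.length := by
  induction s with
  | nil => simp
  | cons a t ih =>
    simp only [List.mem_cons, forall_eq_or_imp] at hF
    simp [List.count_cons, Finset.sum_add_distrib, ih hF.2, hF.1]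

/-- The entropy of a string is at most the logarithm of its number of distinct symbols. -/
theorem length_mul_entropy0_le {s : List A} {F : Finset A} (hF : ∀ x ∈ s, x ∈ F) {K : ℝ}
    (hK : (F.card : ℝ) ≤ K) (hK0 : 0 < K) :
    (s.length : ℝ) * entropy0 s ≤ s.length * Real.logb 2 K := by
  rw [length_mul_entropy0]
  have hsum : ∑ c ∈ F, (s.count c : ℝ) = s.length := by
    exact_mod_cast sum_count_eq_length hF
  have hlog : 0 < Real.log 2 := Real.log_pos one_lt_two
  rw [← Finset.sum_subset (Finset.subset_univ F)]
  -- Gibbs' inequality term by term: `log x ≤ x - 1` at `x = |s| / (n_c K)`. The corrections sum to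
  -- a multiple of `|F| |s| / K - |s| ≤ 0`.
  · have hterm : ∀ c ∈ F, (s.count c : ℝ) * Real.logb 2 ((s.length : ℝ) / s.count c) ≤
        (s.count c : ℝ) * Real.logb 2 K + (s.length / K - s.count c) / Real.log 2 := by
      intro c _
      rcases Nat.eq_zero_or_pos (s.count c) with h | h
      · rw [h]
        simp only [Nat.cast_zero, zero_mul, sub_zero, zero_add]
        positivity
      · have hc : (0 : ℝ) < s.count c := by exact_mod_cast h
        have hl : (0 : ℝ) < s.length := hc.trans_le (by exact_mod_cast List.count_le_length)
        have h1 := Real.log_le_sub_one_of_pos (show 0 < (s.length : ℝ) / s.count c / K by positivity)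
        rw [Real.log_div (by positivity) hK0.ne'] at h1
        have h2 : (s.count c : ℝ) * (s.length / s.count c / K - 1) = s.length / K - s.count c := by
          field_simp
        have h3 := mul_le_mul_of_nonneg_left h1 hc.le
        rw [h2] at h3
        rw [Real.logb, Real.logb, mul_div_assoc', mul_div_assoc', ← add_div]
        gcongr
        linarith
    refine (Finset.sum_le_sum hterm).trans ?_
    rw [Finset.sum_add_distrib, ← Finset.sum_mul, ← Finset.sum_div, Finset.sum_sub_distrib, hsum,
      Finset.sum_const, nsmul_eq_mul]
    have : (F.card : ℝ) * (s.length / K) - s.length ≤ 0 := by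
      rw [mul_div_assoc', sub_nonpos, div_le_iff₀ hK0, mul_comm]
      gcongr
    have := div_nonpos_of_nonpos_of_nonneg this hlog.le
    linarith
  · intro c _ hc
    simp [List.count_eq_zero_of_not_mem (fun h => hc (hF c h))]

theorem length_mul_entropy0_of_uniform {s : List A} {a : ℕ} (ha : 0 < a)
    (hs : ∀ x, s.count x = a) :
    (s.length : ℝ) * entropy0 s = Fintype.card A * a * Real.logb 2 (Fintype.card A) := by
  have hl : s.length = Fintype.card A * a := by
    rw [← sum_count_eq_length (F := Finset.univ) (fun x _ => Finset.mem_univ x)]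
    simp [hs]
  have ha' : (a : ℝ) ≠ 0 := by positivity
  rw [length_mul_entropy0]
  simp only [hs, hl, Nat.cast_mul, mul_div_assoc, div_self ha', mul_one]
  simp [mul_assoc]

end Entropy

theorem List.flatten_map_filter_of_sorted_key {B : Type*} (f : B → ℕ) {l : List B}
    (hl : l.Pairwise (fun a b => f a ≤ f b)) {N : ℕ} (hN : ∀ a ∈ l, f a < N) :
    ((List.range N).map fun j => l.filter (fun a => f a = j)).flatten = l := by
  have key : ∀ N : ℕ, ((List.range N).map fun j => l.filter (fun a => f a = j)).flatten =
      l.filter (fun a => f a < N) := by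
    intro N
    induction N with
    | zero => simp
    | succ N ih =>
      rw [List.range_succ, List.map_append, List.flatten_append, ih]
      clear ih hN
      induction l with
      | nil => simp
      | cons a t ih =>
        rw [List.pairwise_cons] at hl
        have ih := ih hl.2
        simp only [List.map_cons, List.map_nil, List.flatten_cons, List.flatten_nil,
          List.append_nil] at ih ⊢
        rcases lt_trichotomy (f a) N with h | h | h
        · simp [h, h.ne, h.le, ih]
        · have h0 : t.filter (fun b => f b < N) = [] := by
            rw [List.filter_eq_nil_iff]
            intro b hb
            simpa [h] using hl.1 b hb
          rw [h0, List.nil_append] at ih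
          simp [h, h0, ih]
        · simp [h, h.not_gt, h.ne', ih]
  rw [key, List.filter_eq_self]
  simpa using hN

/-! ### The BWT, key partitions and booster partitions. -/

section BWT

variable {A : Type*} [LinearOrder A]

theorem bwtRows_perm (T : List A) :
    (bwtRows T).Perm ((List.range T.length).map (fun i => T.rotate i)) :=
  List.perm_insertionSort _ _

theorem mem_bwtRows {T r : List A} : r ∈ bwtRows T ↔ ∃ p < T.length, T.rotate p = r := by
  simp [(bwtRows_perm T).mem_iff]

theorem pairwise_bwtRows (T : List A) : (bwtRows T).Pairwise (· ≤ ·) :=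
  List.pairwise_insertionSort _ _

theorem ne_nil_of_mem_bwtRows {T r : List A} (hr : r ∈ bwtRows T) : r ≠ [] := by
  obtain ⟨p, hp, rfl⟩ := mem_bwtRows.1 hr
  rw [ne_eq, List.rotate_eq_nil_iff]
  rintro rfl
  simp at hp

theorem getLast?_rotate {A : Type*} {T : List A} {p : ℕ} (hp : p < T.length) :
    (T.rotate p).getLast? = T[(p + (T.length - 1)) % T.length]? := by
  rw [List.getLast?_eq_getElem?, List.length_rotate, List.getElem?_rotate (by omega), add_comm]

/-- Sorting only permutes the rows, and in unsorted order the rotation by `p` ends with the cyclic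
predecessor of `T[p]`, so the last column is a rotation of `T`. -/
theorem bwt_perm (T : List A) : (bwt T).Perm T := by
  have h : ((List.range T.length).map (fun i => T.rotate i)).filterMap List.getLast? =
      T.rotate (T.length - 1) := by
    have h1 : (((List.range T.length).map (fun i => T.rotate i)).filterMap List.getLast?).map some
        = (T.rotate (T.length - 1)).map some := by
      rw [List.map_filterMap_some_eq_filter_map_isSome, List.map_map, List.filter_eq_self.2]
      · apply List.ext_getElem
        · simp
        · intro i h1 h2
          have hi : i < T.length := by simpa using h1
          simp only [List.getElem_map, Function.comp, List.getElem_range, List.getElem_rotate]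
          rw [getLast?_rotate hi, List.getElem?_eq_getElem]
      · intro x hx
        simp only [List.mem_map, List.mem_range, Function.comp] at hx
        obtain ⟨i, hi, rfl⟩ := hx
        rw [getLast?_rotate hi, List.getElem?_eq_getElem (Nat.mod_lt _ (by omega))]
        rfl
    exact List.map_injective_iff.2 (Option.some_injective _) h1
  exact ((bwtRows_perm T).filterMap _).trans (h ▸ T.rotate_perm _)

/-- The key of the first symbol of a row. -/
def headKey (g : A → ℕ) (r : List A) : ℕ := r.head?.elim 0 g

/-- The portion of `bwt T` that lies in the rows whose first symbol has key `j`. -/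
def keyBlock (g : A → ℕ) (T : List A) (j : ℕ) : List A :=
  ((bwtRows T).filter (fun r => headKey g r = j)).filterMap List.getLast?

/-- The partition of `bwt T` according to the key, less than `N`, of the first symbol of a row. -/
def keyPartition (g : A → ℕ) (N : ℕ) (T : List A) : List (List A) :=
  ((List.range N).map (keyBlock g T)).filter (fun s => !s.isEmpty)

theorem isPartition_keyPartition {g : A → ℕ} (hg : Monotone g) {N : ℕ} (hN : ∀ x, g x < N)
    (T : List A) : IsPartition (bwt T) (keyPartition g N T) := by
  refine ⟨fun s hs => by simpa using (List.mem_filter.1 hs).2, ?_⟩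
  rw [keyPartition, List.flatten_filter_not_isEmpty]
  -- Lexicographic order sorts the first symbols, so rows with equal key are contiguous. Rows are
  -- nonempty, hence the default key `0` of `headKey` never matters.
  have hsort : (bwtRows T).Pairwise (fun a b => headKey g a ≤ headKey g b) := by
    refine (pairwise_bwtRows T).imp_of_mem ?_
    intro a b ha hb hab
    obtain ⟨x, a, rfl⟩ := List.exists_cons_of_ne_nil (ne_nil_of_mem_bwtRows ha)
    obtain ⟨y, b, rfl⟩ := List.exists_cons_of_ne_nil (ne_nil_of_mem_bwtRows hb)
    have hxy : x ≤ y := by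
      by_contra h
      exact absurd (List.Lex.rel (not_le.1 h) : y :: b < x :: a) (not_lt.2 hab)
    exact hg hxy
  have hlt : ∀ a ∈ bwtRows T, headKey g a < N := by
    intro a ha
    obtain ⟨x, a, rfl⟩ := List.exists_cons_of_ne_nil (ne_nil_of_mem_bwtRows ha)
    exact hN x
  conv_rhs => rw [bwt, ← List.flatten_map_filter_of_sorted_key (headKey g) hsort hlt]
  rw [List.filterMap_flatten, List.map_map]
  rfl

theorem mem_keyBlock {g : A → ℕ} {T : List A} {j : ℕ} {x : A} (hx : x ∈ keyBlock g T j) :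
    ∃ p, ∃ hp : p < T.length, g T[p] = j ∧
      x = T[(p + (T.length - 1)) % T.length]'(Nat.mod_lt _ (by omega)) := by
  simp only [keyBlock, List.mem_filterMap, List.mem_filter, decide_eq_true_eq] at hx
  obtain ⟨r, ⟨hr, hj⟩, hx⟩ := hx
  obtain ⟨p, hp, rfl⟩ := mem_bwtRows.1 hr
  refine ⟨p, hp, ?_, ?_⟩
  · rwa [headKey, List.head?_rotate hp, List.getElem?_eq_getElem hp] at hj
  · rw [getLast?_rotate hp, List.getElem?_eq_getElem (Nat.mod_lt _ (by omega))] at hx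
    exact (Option.some_injective _ hx).symm

/-- If the keys of `T` are nondecreasing, the symbols preceding those of key `j` have key `j`, with
one exception at most. -/
theorem exists_finset_keyBlock [Fintype A] {g : A → ℕ} {T : List A}
    (hT : T.Pairwise (fun x y => g x ≤ g y)) (j : ℕ) :
    ∃ F : Finset A, F.card ≤ (Finset.univ.filter (fun x => g x = j)).card + 1 ∧
      ∀ x ∈ keyBlock g T j, x ∈ F := by
  have hmono : ∀ p q (hp : p < T.length) (hq : q < T.length), p ≤ q → g T[p] ≤ g T[q] := by
    intro p q hp hq hpq
    rcases hpq.eq_or_lt with rfl | h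
    · rfl
    · exact List.pairwise_iff_getElem.1 hT p q hp hq h
  -- Only the first position of key `j` can be exceptional: at a later one `q`, position `q - 1`
  -- lies between two positions of key `j`.
  have huniq : ∀ p q (hp : p < T.length) (hq : q < T.length), g T[p] = j → g T[q] = j → p < q →
      g (T[(q + (T.length - 1)) % T.length]'(Nat.mod_lt _ (by omega))) = j := by
    intro p q hp hq hpj hqj hpq
    have : (q + (T.length - 1)) % T.length = q - 1 := by
      rw [show q + (T.length - 1) = q - 1 + T.length by omega, Nat.add_mod_right,
        Nat.mod_eq_of_lt (by omega)]
    simp only [this]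
    apply le_antisymm
    · exact hqj ▸ hmono (q - 1) q (by omega) hq (by omega)
    · exact hpj ▸ hmono p (q - 1) hp (by omega) (by omega)
  by_cases h : ∃ p, ∃ hp : p < T.length, g T[p] = j ∧
      g (T[(p + (T.length - 1)) % T.length]'(Nat.mod_lt _ (by omega))) ≠ j
  · obtain ⟨p, hp, hpj, hne⟩ := h
    refine ⟨insert (T[(p + (T.length - 1)) % T.length]'(Nat.mod_lt _ (by omega)))
      (Finset.univ.filter (fun x => g x = j)), Finset.card_insert_le _ _, fun x hx => ?_⟩
    obtain ⟨q, hq, hqj, rfl⟩ := mem_keyBlock hx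
    rcases lt_trichotomy p q with h | rfl | h
    · simp [huniq p q hp hq hpj hqj h]
    · simp
    · exact absurd (huniq q p hq hp hqj hpj h) hne
  · push Not at h
    refine ⟨Finset.univ.filter (fun x => g x = j), Nat.le_succ _, fun x hx => ?_⟩
    obtain ⟨q, hq, hqj, rfl⟩ := mem_keyBlock hx
    simp [h q hq hqj]

/-- The upper bound on the cost of a key partition of a text with nondecreasing keys. -/
theorem partitionCost_keyPartition_le [Fintype A] [Nonempty A] {g : A → ℕ} (hg : Monotone g)
    {N : ℕ} (hN : ∀ x, g x < N) {T : List A} (hT : T.Pairwise (fun x y => g x ≤ g y)) {D : ℕ}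
    (hD : ∀ j, (Finset.univ.filter (fun x => g x = j)).card ≤ D) {lam mu : ℝ} {C : List A → ℝ}
    (hC : IsZeroOrderCost lam mu C) :
    partitionCost C (keyPartition g N T) ≤
      |lam| * (T.length * Real.logb 2 (D + 1)) + |mu| * (N * Real.logb 2 (Fintype.card A)) := by
  have hσ : 0 ≤ Real.logb 2 (Fintype.card A) :=
    Real.logb_nonneg one_lt_two (by exact_mod_cast Fintype.card_pos)
  have hpiece : ∀ s ∈ keyPartition g N T, C s ≤
      (s.length : ℝ) * (|lam| * Real.logb 2 (D + 1)) + |mu| * Real.logb 2 (Fintype.card A) := by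
    intro s hs
    have hne : s ≠ [] := (isPartition_keyPartition hg hN T).1 s hs
    obtain ⟨j, -, rfl⟩ := List.mem_map.1 (List.mem_filter.1 hs).1
    obtain ⟨F, hF, hmem⟩ := exists_finset_keyBlock hT j
    have hent := length_mul_entropy0_le (K := (D : ℝ) + 1) hmem
      (by exact_mod_cast hF.trans (Nat.succ_le_succ (hD j))) (by positivity)
    calc C _ ≤ _ := (hC _ hne).2
      _ ≤ |lam| * (_ * entropy0 _) + |mu| * Real.logb 2 (Fintype.card A) := by
        gcongr
        · exact length_mul_entropy0_nonneg _
        · exact le_abs_self _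
        · exact le_abs_self _
      _ ≤ |lam| * (_ * Real.logb 2 (D + 1)) + |mu| * Real.logb 2 (Fintype.card A) := by gcongr
      _ = _ := by ring
  have hlen : (((keyPartition g N T).map List.length).sum : ℝ) = T.length := by
    rw [← List.length_flatten, (isPartition_keyPartition hg hN T).2, (bwt_perm T).length_eq]
  have hcard : ((keyPartition g N T).length : ℝ) ≤ N := by
    have := List.length_filter_le (fun s => !s.isEmpty) ((List.range N).map (keyBlock g T))
    rw [List.length_map, List.length_range] at this
    exact_mod_cast this
  calc partitionCost C (keyPartition g N T)
      ≤ ((keyPartition g N T).map fun s => (s.length : ℝ) * (|lam| * Real.logb 2 (D + 1)) +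
          |mu| * Real.logb 2 (Fintype.card A)).sum := List.sum_le_sum hpiece
    _ = (T.length : ℝ) * (|lam| * Real.logb 2 (D + 1)) +
          (keyPartition g N T).length * (|mu| * Real.logb 2 (Fintype.card A)) := by
        rw [List.sum_map_add, List.sum_map_mul_right, ← hlen]
        simp [Function.comp_def]
    _ ≤ (T.length : ℝ) * (|lam| * Real.logb 2 (D + 1)) +
          N * (|mu| * Real.logb 2 (Fintype.card A)) := by gcongr
    _ = _ := by ring

theorem contextBlock_nil (T : List A) : contextBlock T [] = bwt T := by
  simp [contextBlock, bwt, List.isPrefixOf]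

theorem contextBlock_ne_nil {T w : List A} (hw : ∃ r ∈ bwtRows T, w <+: r) :
    contextBlock T w ≠ [] := by
  obtain ⟨r, hr, hwr⟩ := hw
  refine List.ne_nil_of_mem (a := r.getLast (ne_nil_of_mem_bwtRows hr)) ?_
  simp only [contextBlock, List.mem_filterMap, List.mem_filter, List.isPrefixOf_iff_prefix]
  exact ⟨r, ⟨hr, hwr⟩, List.getLast?_eq_getLast_of_ne_nil _⟩

/-- The lower bound on the cost of the partitions of the booster. -/
theorem le_partitionCost_of_isBoosterPartition [Fintype A] [Nonempty A] {T : List A} {a : ℕ}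
    (ha : 0 < a) (hT : ∀ x, T.count x = a) {lam mu : ℝ} {C : List A → ℝ}
    (hC : IsZeroOrderCost lam mu C) {P : List (List A)} (hP : IsBoosterPartition T P) :
    (Fintype.card A : ℝ) * Real.logb 2 (Fintype.card A) ≤ partitionCost C P := by
  have hσ : 0 ≤ Real.logb 2 (Fintype.card A) :=
    Real.logb_nonneg one_lt_two (by exact_mod_cast Fintype.card_pos)
  obtain ⟨W, ⟨hsort, hpre, hcov⟩, rfl⟩ := hP
  by_cases hnil : [] ∈ W
  -- The empty word is a prefix of every row, so uniqueness leaves no room for another word; strict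
  -- ordering then excludes repetitions.
  · have hall : ∀ w ∈ W, w = [] := by
      intro w hw
      obtain ⟨r, hr, hwr⟩ := hpre w hw
      exact (hcov r hr).unique ⟨hw, hwr⟩ ⟨hnil, List.nil_prefix⟩
    have hW : W = [[]] := by
      match W, hall, hsort, hnil with
      | [w], hall, _, _ => rw [hall w (by simp)]
      | w :: v :: W, hall, hsort, _ =>
        have h := (List.pairwise_cons.1 hsort).1 v (by simp)
        rw [hall w (by simp), hall v (by simp)] at h
        exact absurd h (lt_irrefl _)
    have hne : bwt T ≠ [] := by
      rw [hW] at hpre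
      simpa [contextBlock_nil] using contextBlock_ne_nil (hpre [] (by simp))
    have hcost := (hC _ hne).1
    rw [length_mul_entropy0_of_uniform ha (fun x => by rw [(bwt_perm T).count_eq, hT])] at hcost
    have : (1 : ℝ) ≤ a := by exact_mod_cast ha
    rw [hW]
    simp only [List.map_cons, List.map_nil, contextBlock_nil, partitionCost, List.sum_cons,
      List.sum_nil, add_zero]
    refine le_trans ?_ ((le_add_of_nonneg_right hσ).trans hcost)
    gcongr
    exact le_mul_of_one_le_right (Nat.cast_nonneg _) this
  · have hcard : Fintype.card A ≤ W.length := by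
      -- Each symbol starts some row, and the nonempty word covering that row starts with the same
      -- symbol.
      have hsub : Finset.univ.image (some : A → Option A) ⊆ (W.map List.head?).toFinset := by
        intro y hy
        obtain ⟨x, -, rfl⟩ := Finset.mem_image.1 hy
        have hx : x ∈ T := List.count_pos_iff.1 (by rw [hT]; exact ha)
        obtain ⟨p, hp, rfl⟩ := List.getElem_of_mem hx
        obtain ⟨w, ⟨hw, hwr⟩, -⟩ := hcov _ (mem_bwtRows.2 ⟨p, hp, rfl⟩)
        rw [List.mem_toFinset, List.mem_map]
        refine ⟨w, hw, ?_⟩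
        obtain ⟨t, ht⟩ := hwr
        have hh := List.head?_rotate hp
        rw [← ht, List.getElem?_eq_getElem hp] at hh
        match w, hw, hh with
        | [], hw, _ => exact absurd hw hnil
        | z :: w, _, hh => simpa using hh
      have h1 := Finset.card_le_card hsub
      rw [Finset.card_image_of_injective _ (Option.some_injective _), Finset.card_univ] at h1
      exact h1.trans ((List.toFinset_card_le _).trans (by simp))
    have hle : ∀ x ∈ (W.map (contextBlock T)).map C, Real.logb 2 (Fintype.card A) ≤ x := by
      intro x hx
      simp only [List.mem_map] at hx
      obtain ⟨s, ⟨w, hw, rfl⟩, rfl⟩ := hx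
      exact logb_card_le_of_isZeroOrderCost hC (contextBlock_ne_nil (hpre w hw))
    have hsum := List.card_nsmul_le_sum _ _ hle
    rw [List.length_map, List.length_map, nsmul_eq_mul] at hsum
    refine le_trans ?_ hsum
    gcongr

end BWT

/-! ### Existence and symbol counts of De Bruijn sequences. -/

section DeBruijn

variable {A : Type*}

/-- The pairs of consecutive symbols of a string, the last symbol being followed by `x`. -/
def pairsTo (x : A) : List A → List (A × A)
  | [] => []
  | a :: t => (a, t.head?.getD x) :: pairsTo x t

theorem zip_tail_append (x : A) (s : List A) : s.zip (s.tail ++ [x]) = pairsTo x s := by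
  induction s with
  | nil => rfl
  | cons a t ih =>
    cases t with
    | nil => rfl
    | cons b t => simpa [pairsTo] using ih

theorem pairsTo_append (x : A) (s t : List A) :
    pairsTo x (s ++ t) = pairsTo (t.head?.getD x) s ++ pairsTo x t := by
  induction s with
  | nil => rfl
  | cons a s ih => cases s <;> simp_all [pairsTo]

theorem pairsTo_flatMap (i : A) (r : List A) :
    pairsTo i (r.flatMap fun k => [i, k]) = r.flatMap fun k => [(i, k), (k, i)] := by
  induction r with
  | nil => rfl
  | cons k r ih => cases r <;> simp_all [pairsTo]

/-- A De Bruijn sequence of order two over a list of distinct symbols. -/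
def deBruijnCycle : List A → List A
  | [] => []
  | [i] => [i]
  | i :: j :: r => i :: i :: (deBruijnCycle (j :: r) ++ j :: r.flatMap fun k => [i, k])

theorem head?_deBruijnCycle (i : A) (r : List A) :
    (deBruijnCycle (i :: r)).head? = some i := by
  cases r <;> simp [deBruijnCycle]

theorem mem_of_mem_deBruijnCycle {l : List A} {x : A} (hx : x ∈ deBruijnCycle l) : x ∈ l := by
  induction l with
  | nil => simp [deBruijnCycle] at hx
  | cons i r ih =>
    cases r with
    | nil => simpa [deBruijnCycle] using hx
    | cons j r =>
      simp only [deBruijnCycle, List.mem_cons, List.mem_append, List.mem_flatMap,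
        List.not_mem_nil, or_false] at hx ih ⊢
      grind

variable [DecidableEq A]

theorem ite_and_eq_mul (p q : Prop) [Decidable p] [Decidable q] :
    (if p ∧ q then 1 else 0) = (if p then 1 else 0) * (if q then 1 else 0 : ℕ) := by
  split_ifs <;> simp_all

theorem count_flatMap_pairs (i : A) (r : List A) (p : A × A) :
    (r.flatMap fun k => [(i, k), (k, i)]).count p =
      (if i = p.1 then 1 else 0) * r.count p.2 + r.count p.1 * (if i = p.2 then 1 else 0) := by
  obtain ⟨x, y⟩ := p
  induction r with
  | nil => simp
  | cons k r ih =>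
    simp only [List.flatMap_cons, List.count_append, ih, List.count_cons, List.count_nil,
      beq_iff_eq, Prod.mk.injEq, ite_and_eq_mul]
    ring

/-- The new symbol `i` adds the pairs `(i, i)`, `(i, j)`, `(j, i)` and, for `k` in `r`, `(i, k)` and
`(k, i)`. The old cycle starts with `j` and is followed by `j`, so its cyclic pairs survive.
Products of counts make the induction an expansion and need no distinctness. -/
theorem count_pairsTo_deBruijnCycle (i : A) (r : List A) (p : A × A) :
    (pairsTo i (deBruijnCycle (i :: r))).count p =
      (i :: r).count p.1 * (i :: r).count p.2 := by
  induction r generalizing i with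
  | nil =>
    obtain ⟨x, y⟩ := p
    simp only [deBruijnCycle, pairsTo, List.head?_nil, Option.getD_none, List.count_cons,
      List.count_nil, beq_iff_eq, Prod.mk.injEq, ite_and_eq_mul]
    ring
  | cons j r ih =>
    have hpairs : pairsTo i (deBruijnCycle (i :: j :: r)) =
        (i, i) :: (i, j) :: (pairsTo j (deBruijnCycle (j :: r)) ++
          (j, i) :: r.flatMap fun k => [(i, k), (k, i)]) := by
      have hhead : (r.flatMap fun k => [i, k]).head?.getD i = i := by cases r <;> simp
      simp [deBruijnCycle, pairsTo, pairsTo_append, head?_deBruijnCycle, pairsTo_flatMap, hhead]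
    rw [hpairs]
    simp only [List.count_cons, List.count_append, count_flatMap_pairs, ih]
    obtain ⟨x, y⟩ := p
    simp only [beq_iff_eq, Prod.mk.injEq, ite_and_eq_mul]
    ring

theorem exists_isDeBruijn (B : Finset A) : ∃ s, IsDeBruijn B s := by
  refine ⟨deBruijnCycle B.toList, fun x hx => by simpa using mem_of_mem_deBruijnCycle hx,
    fun x hx y hy => ?_⟩
  have hnd := B.nodup_toList
  rw [← Finset.mem_toList] at hx hy
  obtain ⟨i, r, hl⟩ := List.exists_cons_of_ne_nil (List.ne_nil_of_mem hx)
  rw [hl] at hx hy hnd ⊢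
  obtain ⟨t, ht⟩ := List.head?_eq_some_iff.1 (head?_deBruijnCycle i r)
  have hrot : (deBruijnCycle (i :: r)).rotate 1 = (deBruijnCycle (i :: r)).tail ++ [i] := by
    simp [ht]
  rw [hrot, zip_tail_append, count_pairsTo_deBruijnCycle, List.count_eq_one_of_mem hnd hx,
    List.count_eq_one_of_mem hnd hy]

theorem exists_isDeBruijnConcat (σ a : ℕ) : ∃ T : List (Fin σ), IsDeBruijnConcat σ a T := by
  choose S hS using fun i => exists_isDeBruijn (subAlphabet σ a i)
  exact ⟨_, S, fun i _ => hS i, rfl⟩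

theorem sum_count_pair {l : List (A × A)} {B : Finset A} (hl : ∀ p ∈ l, p.2 ∈ B) (x : A) :
    ∑ y ∈ B, l.count (x, y) = (l.map Prod.fst).count x := by
  induction l with
  | nil => simp
  | cons p l ih =>
    obtain ⟨u, v⟩ := p
    simp only [List.mem_cons, forall_eq_or_imp] at hl
    by_cases hu : u = x <;>
      simp [List.count_cons, Finset.sum_add_distrib, ih hl.2, hl.1, hu]

/-- Each occurrence of `x` starts one cyclic pair, and there is one such pair for every second
symbol in `B`. -/
theorem IsDeBruijn.count_eq {B : Finset A} {s : List A} (hs : IsDeBruijn B s) {x : A}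
    (hx : x ∈ B) : s.count x = B.card := by
  have h := sum_count_pair (l := s.zip (s.rotate 1)) (B := B)
    (fun p hp => hs.1 _ (List.mem_rotate.1 (List.of_mem_zip (a := p.1) (b := p.2) hp).2)) x
  rw [List.map_fst_zip (by simp), Finset.sum_congr rfl (hs.2 x hx)] at h
  simpa using h.symm

end DeBruijn

/-! ### Symbol counts and order of groups in the concatenated texts. -/

theorem card_filter_div_eq {N d j : ℕ} (hd : 0 < d) :
    (Finset.univ.filter (fun x : Fin N => (x : ℕ) / d = j)).card ≤ d := by
  rw [← Finset.card_map Fin.valEmbedding]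
  refine (Finset.card_le_card (t := Finset.Ico (j * d) ((j + 1) * d)) ?_).trans ?_
  · intro y hy
    simp only [Finset.mem_map, Finset.mem_filter, Finset.mem_univ, true_and] at hy
    obtain ⟨x, hx, rfl⟩ := hy
    rw [Nat.div_eq_iff hd] at hx
    rw [Finset.mem_Ico, Fin.valEmbedding_apply, Nat.succ_mul]
    omega
  · simp [Nat.succ_mul]

theorem card_subAlphabet {σ a i : ℕ} (ha : 0 < a) (hi : i < σ / a) :
    (subAlphabet σ a i).card = a := by
  have h : (subAlphabet σ a i).map Fin.valEmbedding = Finset.Ico (i * a) ((i + 1) * a) := by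
    ext y
    simp only [subAlphabet, Finset.mem_map, Finset.mem_filter, Finset.mem_univ, true_and,
      Finset.mem_Ico, Fin.valEmbedding_apply]
    constructor
    · rintro ⟨x, hx, rfl⟩
      rw [Nat.div_eq_iff ha] at hx
      rw [Nat.succ_mul]
      omega
    · rintro ⟨h1, h2⟩
      have h3 : (i + 1) * a ≤ σ := (Nat.mul_le_mul_right a hi).trans (Nat.div_mul_le_self σ a)
      refine ⟨⟨y, by omega⟩, ?_, rfl⟩
      rw [Nat.succ_mul] at h2
      rw [Nat.div_eq_iff ha]
      constructor <;> simp only <;> omega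
  rw [← Finset.card_map Fin.valEmbedding, h, Nat.card_Ico, Nat.succ_mul]
  omega

theorem IsDeBruijnConcat.count_eq {σ a : ℕ} (ha : 0 < a) (hd : a ∣ σ) {T : List (Fin σ)}
    (hT : IsDeBruijnConcat σ a T) (x : Fin σ) : T.count x = a := by
  obtain ⟨S, hS, rfl⟩ := hT
  have hx : (x : ℕ) / a < σ / a := Nat.div_lt_div_of_lt_of_dvd hd x.2
  have hcount : ∀ i < σ / a, (S i).count x = if i = (x : ℕ) / a then a else 0 := by
    intro i hi
    split_ifs with h
    · rw [(hS i hi).count_eq (by simp [subAlphabet, h]), card_subAlphabet ha hi]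
    · refine List.count_eq_zero_of_not_mem fun hmem => h ?_
      simpa [subAlphabet, eq_comm] using (hS i hi).1 x hmem
  rw [List.count_flatten, List.map_map]
  have : (List.map (List.count x ∘ S) (List.range (σ / a))).sum =
      ∑ i ∈ Finset.range (σ / a), (S i).count x := rfl
  rw [this, Finset.sum_congr rfl fun i hi => hcount i (Finset.mem_range.1 hi)]
  simp [hx]

theorem IsDeBruijnConcat.length_eq {σ a : ℕ} (ha : 0 < a) (hd : a ∣ σ) {T : List (Fin σ)}
    (hT : IsDeBruijnConcat σ a T) : T.length = σ * a := by
  rw [← sum_count_eq_length (F := Finset.univ) (fun x _ => Finset.mem_univ x)]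
  simp [hT.count_eq ha hd]

theorem IsDeBruijnConcat.pairwise {σ a : ℕ} {T : List (Fin σ)} (hT : IsDeBruijnConcat σ a T) :
    T.Pairwise (fun x y : Fin σ => (x : ℕ) / a ≤ (y : ℕ) / a) := by
  obtain ⟨S, hS, rfl⟩ := hT
  have hmem : ∀ i < σ / a, ∀ x ∈ S i, (x : ℕ) / a = i := fun i hi x hx => by
    simpa [subAlphabet] using (hS i hi).1 x hx
  rw [List.pairwise_flatten]
  constructor
  · intro l hl
    obtain ⟨i, hi, rfl⟩ := List.mem_map.1 hl
    rw [List.mem_range] at hi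
    exact List.pairwise_of_forall_mem_list fun x hx y hy =>
      ((hmem i hi x hx).trans (hmem i hi y hy).symm).le
  · rw [List.pairwise_map]
    refine List.pairwise_lt_range.imp_of_mem ?_
    intro i j hi hj hij x hx y hy
    rw [List.mem_range] at hi hj
    rw [hmem i hi x hx, hmem j hj y hy]
    exact hij.le

/-! ### Comparison of costs and choice of parameters. -/

/-- The ratio between the cost of a booster partition and that of the partition according to groups
of `D = a * q` consecutive first symbols. -/
theorem keyPartition_le_boosterPartition {q a D σ : ℕ} (hq : 0 < q) (ha : 0 < a) (hD : D = 2 ^ q)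
    (haq : a * q = D) (hσ : σ = 2 ^ (D ^ 2)) (hdvd : D ∣ σ) {lam mu : ℝ}
    {T : List (Fin σ)} (hT : IsDeBruijnConcat σ a T) {C : List (Fin σ) → ℝ}
    (hC : IsZeroOrderCost lam mu C) {P : List (List (Fin σ))} (hP : IsBoosterPartition T P) :
    1 / (2 * (2 * |lam| + |mu| + 1)) * √(Real.logb 2 T.length) *
      partitionCost C (keyPartition (fun x : Fin σ => (x : ℕ) / D) (σ / D) T) ≤
      partitionCost C P := by
  have hD0 : 0 < D := haq ▸ Nat.mul_pos ha hq
  have hσ0 : 0 < σ := hσ ▸ by positivity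
  have hda : a ∣ σ := (Dvd.intro _ haq).trans hdvd
  have : Nonempty (Fin σ) := ⟨⟨0, hσ0⟩⟩
  have hlogσ : Real.logb 2 σ = (D : ℝ) ^ 2 := by
    rw [hσ, Nat.cast_pow, Nat.cast_ofNat, Real.logb_pow, Real.logb_self_eq_one one_lt_two]
    push_cast
    ring
  have hlogD : Real.logb 2 D = q := by
    rw [hD, Nat.cast_pow, Nat.cast_ofNat, Real.logb_pow, Real.logb_self_eq_one one_lt_two, mul_one]
  -- Blocks of `D = a * q` symbols are unions of groups of `a`, so the order of groups passes to
  -- blocks.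
  have hkey : T.Pairwise (fun x y : Fin σ => (x : ℕ) / D ≤ (y : ℕ) / D) := by
    refine hT.pairwise.imp fun {x y} h => ?_
    rw [← haq, ← Nat.div_div_eq_div_mul, ← Nat.div_div_eq_div_mul]
    exact Nat.div_le_div_right h
  have hupper := partitionCost_keyPartition_le (g := fun x : Fin σ => (x : ℕ) / D)
    (fun x y h => Nat.div_le_div_right h) (N := σ / D)
    (fun x => Nat.div_lt_div_of_lt_of_dvd hdvd x.2) hkey (D := D)
    (fun j => card_filter_div_eq hD0) hC
  have hlower := le_partitionCost_of_isBoosterPartition ha (hT.count_eq ha hda) hC hP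
  rw [hT.length_eq ha hda] at hupper ⊢
  rw [Fintype.card_fin, hlogσ] at hlower hupper
  have hDr : (0 : ℝ) < D := by exact_mod_cast hD0
  have hσr : (0 : ℝ) < σ := by exact_mod_cast hσ0
  have har : (0 : ℝ) < a := by exact_mod_cast ha
  have hqr : (1 : ℝ) ≤ q := by exact_mod_cast hq
  have haqr : (a : ℝ) * q = D := by exact_mod_cast haq
  have haD : (a : ℝ) ≤ D := by nlinarith
  have hD1 : Real.logb 2 ((D : ℝ) + 1) ≤ 2 * q := by
    calc Real.logb 2 ((D : ℝ) + 1) ≤ Real.logb 2 (2 * D) := by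
          have : (1 : ℝ) ≤ D := by exact_mod_cast hD0
          exact Real.logb_le_logb_of_le one_lt_two (by positivity) (by linarith)
      _ = 1 + q := by
          rw [Real.logb_mul two_ne_zero hDr.ne', Real.logb_self_eq_one one_lt_two, hlogD]
      _ ≤ 2 * q := by linarith
  have hNr : ((σ / D : ℕ) : ℝ) = σ / D := Nat.cast_div hdvd hDr.ne'
  -- Entropy gives `2 * |lam|`, headers give `|mu|`; the extra `1` keeps the constant positive when
  -- both vanish.
  have hupper' : partitionCost C (keyPartition (fun x : Fin σ => (x : ℕ) / D) (σ / D) T) ≤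
      (2 * |lam| + |mu| + 1) * (σ * D) := by
    refine hupper.trans ?_
    have h1 : ((σ * a : ℕ) : ℝ) * Real.logb 2 (D + 1) ≤ 2 * (σ * D) := by
      push_cast
      calc (σ : ℝ) * a * Real.logb 2 (D + 1) ≤ σ * a * (2 * q) := by gcongr
        _ = 2 * (σ * (a * q)) := by ring
        _ = _ := by rw [haqr]
    have h2 : ((σ / D : ℕ) : ℝ) * (D : ℝ) ^ 2 = σ * D := by
      rw [hNr]
      field_simp
    rw [h2]
    have := mul_le_mul_of_nonneg_left h1 (abs_nonneg lam)
    have : 0 < (σ : ℝ) * D := by positivity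
    linarith
  -- Here `log n = D ^ 2 + log a ≤ D ^ 2 + D ≤ 4 * D ^ 2`.
  have hsqrt : √(Real.logb 2 ((σ * a : ℕ) : ℝ)) ≤ 2 * D := by
    rw [Real.sqrt_le_left (by positivity), Nat.cast_mul, Real.logb_mul hσr.ne' har.ne', hlogσ]
    have h1 : Real.logb 2 (a : ℝ) ≤ q :=
      hlogD ▸ Real.logb_le_logb_of_le one_lt_two har haD
    have h2 : (q : ℝ) ≤ D := by
      rw [hD]
      exact_mod_cast Nat.lt_two_pow_self.le
    have h3 : (1 : ℝ) ≤ D := hqr.trans h2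
    nlinarith
  refine le_trans ?_ hlower
  have hM : 0 < 2 * |lam| + |mu| + 1 := by positivity
  calc _ ≤ 1 / (2 * (2 * |lam| + |mu| + 1)) * √(Real.logb 2 ((σ * a : ℕ) : ℝ)) *
        ((2 * |lam| + |mu| + 1) * (σ * D)) := by gcongr
    _ ≤ 1 / (2 * (2 * |lam| + |mu| + 1)) * (2 * D) * ((2 * |lam| + |mu| + 1) * (σ * D)) := by
        gcongr
    _ = σ * (D : ℝ) ^ 2 := by field_simp

theorem mainTheorem6 :
    ∃ (σ α : ℕ → ℕ) (Q : (m : ℕ) → List (Fin (σ m)) → List (List (Fin (σ m)))),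
      StrictMono σ ∧
      (∀ m, 0 < α m ∧ α m ∣ σ m) ∧
      (fun m => (α m : ℝ)) =Θ[atTop]
        (fun m => √(Real.logb 2 (σ m)) / Real.logb 2 (Real.logb 2 (σ m))) ∧
      (∀ m, ∃ T : List (Fin (σ m)), IsDeBruijnConcat (σ m) (α m) T) ∧
      (∀ m, ∀ T : List (Fin (σ m)), IsDeBruijnConcat (σ m) (α m) T →
        IsPartition (bwt T) (Q m T)) ∧
      ∀ lam mu : ℝ, ∃ c : ℝ, 0 < c ∧
        ∀ m, ∀ T : List (Fin (σ m)), IsDeBruijnConcat (σ m) (α m) T →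
          ∀ C : List (Fin (σ m)) → ℝ, IsZeroOrderCost lam mu C →
            ∀ P : List (List (Fin (σ m))), IsBoosterPartition T P →
              c * √(Real.logb 2 T.length) * partitionCost C (Q m T) ≤ partitionCost C P := by
  -- The double exponential makes `D`, `log D = 2 ^ m` and their quotient `α m` powers of two, so
  -- all divisibilities are exact.
  obtain ⟨D, hD⟩ : ∃ D : ℕ → ℕ, ∀ m, D m = 2 ^ 2 ^ m := ⟨_, fun _ => rfl⟩
  obtain ⟨σ, hσ⟩ : ∃ σ : ℕ → ℕ, ∀ m, σ m = 2 ^ (D m ^ 2) := ⟨_, fun _ => rfl⟩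
  obtain ⟨α, hα⟩ : ∃ α : ℕ → ℕ, ∀ m, α m = 2 ^ (2 ^ m - m) := ⟨_, fun _ => rfl⟩
  have hα0 : ∀ m, 0 < α m := fun m => hα m ▸ by positivity
  have hαD : ∀ m, α m * 2 ^ m = D m := fun m => by
    rw [hα, hD, ← pow_add, Nat.sub_add_cancel Nat.lt_two_pow_self.le]
  have hDσ : ∀ m, D m ∣ σ m := fun m => by
    have h1 : 2 ^ m ≤ D m := hD m ▸ Nat.lt_two_pow_self.le
    rw [hσ, hD m, ← hD m]
    nth_rewrite 1 [hD m]
    exact pow_dvd_pow 2 (h1.trans (Nat.le_self_pow two_ne_zero _))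
  refine ⟨σ, α, fun m T => keyPartition (fun x : Fin (σ m) => (x : ℕ) / D m) (σ m / D m) T, ?_,
    fun m => ⟨hα0 m, (Dvd.intro _ (hαD m)).trans (hDσ m)⟩, ?_,
    fun m => exists_isDeBruijnConcat _ _, fun m T _ => ?_, fun lam mu => ?_⟩
  · intro m n hmn
    rw [hσ, hσ, hD, hD]
    exact Nat.pow_lt_pow_right one_lt_two (Nat.pow_lt_pow_left (Nat.pow_lt_pow_right one_lt_two
      (Nat.pow_lt_pow_right one_lt_two hmn)) two_ne_zero)
  -- Since `log log σ = 2 * log D`, the asymptotic relation is an equality with factor `2`.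
  · have h : (fun m => (α m : ℝ)) =
        fun m => 2 * (√(Real.logb 2 (σ m)) / Real.logb 2 (Real.logb 2 (σ m))) := by
      funext m
      have h1 : Real.logb 2 (σ m) = (D m : ℝ) ^ 2 := by
        rw [hσ, Nat.cast_pow, Nat.cast_ofNat, Real.logb_pow, Real.logb_self_eq_one one_lt_two]
        push_cast
        ring
      have h2 : Real.logb 2 (D m) = 2 ^ m := by
        rw [hD, Nat.cast_pow, Nat.cast_ofNat, Real.logb_pow, Real.logb_self_eq_one one_lt_two]
        push_cast
        ring
      rw [h1, Real.sqrt_sq (Nat.cast_nonneg _), Real.logb_pow, h2, ← hαD]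
      push_cast
      field_simp
    rw [h]
    exact (isTheta_refl _ _).const_mul_left two_ne_zero
  · exact isPartition_keyPartition (g := fun x : Fin (σ m) => (x : ℕ) / D m)
      (fun x y h => Nat.div_le_div_right h) (fun x => Nat.div_lt_div_of_lt_of_dvd (hDσ m) x.2) T
  · exact ⟨1 / (2 * (2 * |lam| + |mu| + 1)), by positivity, fun m T hT C hC P hP =>
      keyPartition_le_boosterPartition (by positivity) (hα0 m) (hD m) (hαD m) (hσ m)
        (hDσ m) hT hC hP⟩
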